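/- Let $H(10,7)$ be the Gilbert–Howie group with generators $x_0,\dots,x_9$ and defining relations $x_i x_{i+7}=x_{i+1}$ $(0\le i<10$, subscripts modulo $10)$. Then: (a) $H(10,7)$ is not (Gromov) hyperbolic. Moreover, $H(10,7)$ contains the Klein bottle group $BS(1,-1)=\langle a,b \mid bab^{-1}=a^{-1}\rangle$: the assignment $a\mapsto x_0x_5$, $b\mapsto x_1x_0x_2x_1x_3$ extends to an injective homomorphism $BS(1,-1)\to H(10,7)$. (b) $H(10,7)$ contains a non-abelian free subgroup: writing $y_j=x_{2j}$, the elements $y_0^2=x_0^2$ and $y_4^2=x_8^2$ freely generate a free subgroup of rank $2$. -/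

import Mathlib

/-- The relators `x_i x_{i+m} x_{i+k}⁻¹` (`i` modulo `n`) of the presentation `P_n(m,k)`. -/
def fibonacciTypeRels (n m k : ℕ) : Set (FreeGroup (ZMod n)) :=
  Set.range fun i : ZMod n =>
    FreeGroup.of i * FreeGroup.of (i + (m : ZMod n)) * (FreeGroup.of (i + (k : ZMod n)))⁻¹

/-- The group of Fibonacci type `G_n(m,k) = ⟨x_0, …, x_{n-1} | x_i x_{i+m} = x_{i+k}⟩`,
subscripts modulo `n`. -/
abbrev FibonacciTypeGroup (n m k : ℕ) : Type := PresentedGroup (fibonacciTypeRels n m k)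

/-- The Gilbert–Howie group `H(n,m) = G_n(m,1)`. -/
abbrev GilbertHowieGroup (n m : ℕ) : Type := FibonacciTypeGroup n m 1

/-- The defining generator `x_i` of `H(n,m)`, with `i` modulo `n`. -/
def GilbertHowieGroup.x {n m : ℕ} (i : ZMod n) : GilbertHowieGroup n m := PresentedGroup.of i

/-- The relator `b a^p b⁻¹ a^{-q}`, where the letters `a`, `b` are indexed by `0`, `1`. -/
def baumslagSolitarRels (p q : ℤ) : Set (FreeGroup (Fin 2)) :=
  {FreeGroup.of 1 * FreeGroup.of 0 ^ p * (FreeGroup.of 1)⁻¹ * (FreeGroup.of 0 ^ q)⁻¹}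

/-- The Baumslag–Solitar group `BS(p,q) = ⟨a, b | b a^p b⁻¹ = a^q⟩`. -/
abbrev BaumslagSolitarGroup (p q : ℤ) : Type := PresentedGroup (baumslagSolitarRels p q)

/-- The generator `a` of `BS(p,q)`. -/
def BaumslagSolitarGroup.a {p q : ℤ} : BaumslagSolitarGroup p q := PresentedGroup.of 0

/-- The generator `b` of `BS(p,q)`. -/
def BaumslagSolitarGroup.b {p q : ℤ} : BaumslagSolitarGroup p q := PresentedGroup.of 1

/-- The Gromov product `(g | h)_w` with respect to the word metric of `S`, that is, the path metric
on the vertices of the Cayley graph of `G` (meant for `S` generating `G`). -/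
noncomputable def wordGromovProduct {G : Type*} [Group G] (S : Set G) (g h w : G) : ℝ :=
  (((SimpleGraph.mulCayley S).dist g w : ℝ) + ((SimpleGraph.mulCayley S).dist h w : ℝ)
    - ((SimpleGraph.mulCayley S).dist g h : ℝ)) / 2

/-- A group is (Gromov) hyperbolic if it has a finite generating set whose word metric is
`δ`-hyperbolic for some `δ`: `(g | k)_w ≥ min {(g | h)_w, (h | k)_w} - δ` for all `g, h, k, w`. -/
def IsHyperbolicGroup (G : Type*) [Group G] : Prop :=
  ∃ S : Set G, S.Finite ∧ Subgroup.closure S = ⊤ ∧ ∃ δ : ℝ, ∀ g h k w : G,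
    min (wordGromovProduct S g h w) (wordGromovProduct S h k w) - δ ≤ wordGromovProduct S g k w

/-! The group acts on the right on explicit normal forms (`Valid` words), and everything rests on
the length `len g` of the normal form that `g` produces from the empty word. The letters are the
`x_i` and their inverses, and each defining relation is a triangle of letters. Multiplying a normal
form by a letter appends a letter, moves along the sphere of the same length (possibly appending
afterwards), or shortens the word. Which of these happens is read off from a finite automaton whose
state is a type and the index of the last letter.

A move that does not simply append is passed on to the parent (the word without its last letter).
Hence the triangle relations can be proved by induction on normal forms: up to a cyclic shift of
indices, the inductive step involves only the parent's state and the last letter, so it is a finite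
computation (`latCheck_all`, `mulCheck_all`, leading to `isLateral` and `act_act`). Uniqueness of
normal forms is not needed; an action is enough.

The automaton also certifies that suitable words lengthen every normal form they meet (`rises_spec`,
`actWord_flatMap`). Thus `len (kleinA ^ n) = 2 * n`, `len (kleinB ^ n) = 5 * n`, and a reduced word
of length n in the two squares has length 2n, so the squares generate freely. The Klein bottle
relation follows from the triangles by hand, and the infinite order of both generators makes
`kleinHom` injective.

For non-hyperbolicity, let u be a power of a and v a power of b². These commute, and conjugation by
b exchanges uv and u⁻¹v, so these have nearly equal norms. Two uses of the four-point condition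
bound |u²| + |v²| by 2 max(|u|, |v|) plus a constant. This contradicts the linear growth of both
families (`false_of_doubling`). -/

namespace GilbertHowie

/-! ### The automaton and its symbolic consistency checks. -/

/-- The effect of right multiplication by a letter on a normal form, as far as it is determined by
the type of the normal form: the letter is appended, giving type `t`; or it is the product of a
letter `h` along the sphere and the appended letter `c`; or the last letter is replaced by `b` after
multiplying the remaining word by `g`, the possible types being listed; or the last letter is
dropped after such a multiplication. -/
inductive Move where
  | child (t : ℕ)
  | side (h c : Fin 20)
  | lat (g : Option (Fin 20)) (b : Fin 20) (ts : List ℕ)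
  | down (g : Option (Fin 20))
  deriving DecidableEq

open Move in
/-- The moves of the 33 types of normal forms and of the empty word (the last row), the entries of a
row being indexed by the letters relative to the last letter of the normal form. -/
def moveTable : List (List Move) := [
  [child 0, down none, child 2, child 3, child 0, child 4, child 2, child 1, child 0,
   lat none 7 [1, 4, 6, 11, 13, 20, 21, 29], child 5, child 1, side 14 7, lat none 18 [0, 2,
   7, 14, 25], lat none 2 [0, 2, 5, 15, 30], child 1, side 14 8, child 6, child 7, child 8],
  [down none, child 9, lat none 14 [0], child 8, side 2 16, side 18 7, child 7, lat none 9
   [1, 3, 8], child 0, side 2 11, child 0, child 3, child 0, child 10, child 5, child 6,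
   side 18 11, child 11, lat none 13 [1, 3, 8], child 4],
  [side 2 15, down none, lat (some 7) 10 [7, 12, 14], child 3, side 2 16, child 13, child
   14, child 8, child 0, down (some 7), child 15, child 3, side 14 7, lat none 18 [0, 7],
   lat none 2 [0, 5], child 1, side 14 8, lat (some 7) 15 [3, 18, 19, 26], child 12, child
   8],
  [down none, child 16, lat (some 12) 6 [2, 14, 15], child 8, side 2 16, side 18 7, child
   7, lat none 9 [1, 3, 4, 8], child 0, side 2 11, child 0, child 3, child 0, child 10,
   child 5, child 6, side 18 11, child 11, lat none 13 [1, 3, 8, 24], child 4],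
  [down none, child 9, lat none 14 [0, 5, 7], child 17, side 2 16, side 18 7, child 7,
   down (some 9), child 2, side 2 11, child 0, child 18, child 2, child 10, child 5, lat
   (some 9) 13 [8, 17, 22, 24, 27, 32], side 18 11, child 11, lat none 13 [3, 6, 19, 28], lat
   (some 9) 4 [5, 12, 15, 30]],
  [child 0, down none, child 2, child 3, child 0, child 4, child 2, child 1, child 0,
   lat none 7 [4, 6, 9, 16], child 5, child 1, side 14 7, lat none 18 [0, 2], lat (some 4)
   17 [4, 13, 18, 21, 27, 31], child 1, side 14 8, child 6, child 7, child 8],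
  [down none, child 22, lat none 14 [0, 5, 7], side 16 5, side 2 16, lat (some 13) 7 [10,
   11, 19, 21, 28], child 7, lat none 9 [4, 8, 22, 32], child 0, side 2 11, child 0, child
   19, child 5, child 6, side 16 9, child 20, lat (some 13) 11 [9, 11, 20, 22], child 21,
   down (some 13), child 4],
  [child 0, down none, child 2, child 3, child 0, child 4, child 2, child 1, child 0,
   lat none 7 [4, 6, 10, 20, 31], child 5, child 1, side 14 7, lat (some 16) 10 [2, 14, 15],
   lat none 2 [0, 2, 25], child 1, side 14 8, child 6, child 7, child 8],
  [down none, child 9, lat (some 16) 9 [4, 13, 18, 21, 27, 31], child 8, side 2 16, side 18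
   7, child 7, lat none 9 [1, 3, 8], child 0, side 2 11, child 0, child 3, child 0, child
   10, child 5, child 6, side 18 11, child 11, lat none 13 [1, 3, 6, 8], child 4],
  [down none, child 9, lat none 14 [5], child 8, side 2 16, side 18 7, child 7, lat (some
   2) 11 [6, 17, 23], child 0, side 2 11, child 0, child 3, child 0, child 10, child 5,
   child 6, side 18 11, child 11, lat none 13 [10], child 4],
  [down none, child 9, lat none 14 [7], child 8, side 2 16, side 18 7, child 7, lat none 9
   [9, 16], child 0, side 2 11, child 0, child 3, child 0, child 10, child 5, child 6,
   side 18 11, child 11, lat (some 6) 15 [6, 13, 20, 26], child 4],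
  [down none, child 9, lat none 14 [0], child 8, side 2 16, side 18 7, child 7, lat (some
   2) 11 [6, 20, 26], child 0, side 2 11, child 0, child 3, child 0, child 10, child 5,
   child 6, side 18 11, child 11, lat (some 6) 15 [6, 13, 17, 23], child 4],
  [child 0, down none, child 2, child 3, child 0, child 4, child 2, child 1, child 0,
   lat none 7 [13], child 5, child 1, side 14 7, lat (some 16) 10 [2], lat (some 4) 17 [4,
   13], child 1, side 14 8, child 6, child 7, child 8],
  [down none, child 22, lat none 14 [0, 12], child 23, side 2 16, lat (some 13) 7 [10, 11,
   21], child 7, down (some 9), child 2, side 2 11, child 0, child 18, child 15, child 6,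
   side 16 9, lat (some 9) 13 [8], lat (some 13) 11 [16, 29, 32], child 21, down (some 13),
   lat (some 9) 4 [5, 12]],
  [side 2 15, down none, lat (some 7) 10 [7, 14], child 3, side 2 16, child 13, child 14,
   child 8, child 0, down (some 7), child 15, child 3, side 14 7, lat (some 16) 10 [2, 14],
   lat none 2 [0], child 1, side 14 8, lat (some 7) 15 [3], child 12, child 8],
  [side 2 15, down none, lat (some 7) 10 [7], child 3, side 2 16, child 13, child 14,
   child 8, child 0, down (some 7), child 15, child 3, side 14 7, lat none 18 [0], lat
   (some 4) 17 [4, 18], child 1, side 14 8, lat (some 7) 15 [3, 18, 19], child 12, child 8],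
  [down none, child 9, lat none 14 [5], child 24, side 2 16, side 18 7, child 7, lat (some
   2) 11 [13], child 25, side 2 11, child 0, child 3, child 0, child 10, child 5, side 7
   13, side 18 11, child 11, lat none 13 [10], child 4],
  [down none, child 22, lat (some 16) 9 [4, 21], side 16 5, side 2 16, lat (some 13) 7 [11,
   21, 29], child 7, lat none 9 [18], child 0, side 2 11, child 0, child 19, child 5,
   child 6, side 16 9, child 20, lat (some 13) 11 [9, 22], child 21, down (some 13), child
   4],
  [down none, child 16, lat (some 12) 6 [2, 15], child 17, side 2 16, side 18 7, child 7,
   down (some 9), child 2, side 2 11, child 0, child 18, child 2, child 10, child 5, lat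
   (some 9) 13 [8], side 18 11, child 11, lat none 13 [17, 23], lat (some 9) 4 [5, 15]],
  [down none, child 16, lat (some 12) 6 [2, 15], child 8, side 2 16, side 18 7, child 7,
   lat none 9 [4], child 0, side 2 11, child 0, child 3, child 0, child 10, child 5,
   child 6, side 18 11, child 11, lat (some 6) 15 [6, 20], child 4],
  [down none, child 22, lat none 14 [0, 7], side 16 5, side 2 16, lat (some 13) 7 [10, 19],
   child 7, lat (some 2) 11 [6, 20], child 0, side 2 11, child 0, child 19, child 5, child
   6, side 16 9, child 20, lat (some 13) 11 [11, 20], child 21, down (some 13), child 4],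
  [down none, child 9, lat none 14 [0], child 17, side 2 16, side 18 7, child 7, down
   (some 9), child 2, side 2 11, child 0, child 18, child 2, child 10, child 5, lat (some
   9) 13 [8, 17, 22, 24], side 18 11, child 11, lat (some 6) 15 [6, 13, 17], lat (some 9) 4
   [5]],
  [down none, child 9, lat (some 16) 9 [4, 21], child 8, side 2 16, side 18 7, child 7,
   lat (some 2) 11 [6, 17], child 0, side 2 11, child 0, child 3, child 0, child 10, child
   5, child 6, side 18 11, child 11, lat none 13 [6], child 4],
  [down none, child 27, down (some 14), side 16 5, lat (some 14) 16 [25], lat (some 13) 7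
   [11], side 4 18, lat none 9 [18], child 7, lat (some 14) 11 [24], child 0, child 28,
   child 5, child 26, side 16 9, child 20, lat (some 13) 11 [9], child 13, down (some 13),
   child 4],
  [down none, child 9, lat (some 16) 9 [4, 21], child 8, side 2 16, side 18 7, child 7,
   lat none 9 [3], child 0, side 2 11, child 0, child 3, child 0, child 10, child 5,
   child 6, side 18 11, child 29, lat (some 5) 11 [23], child 4],
  [child 0, down none, child 2, child 3, child 0, child 31, child 2, child 1, child 0,
   lat (some 19) 5 [23], child 30, child 1, side 14 7, lat none 18 [7], lat none 2 [0],
   child 1, side 14 8, side 9 15, child 7, child 8],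
  [down none, child 32, lat (some 12) 6 [2], side 16 5, side 2 16, lat (some 13) 7 [10],
   child 7, lat none 9 [27], child 0, side 2 11, child 0, child 19, child 5, child 6,
   side 16 9, child 20, lat (some 13) 11 [11], child 21, down (some 13), child 4],
  [down none, child 9, lat (some 16) 9 [4], child 17, side 2 16, side 18 7, child 7, down
   (some 9), child 2, side 2 11, child 0, child 18, child 2, child 10, child 5, lat (some
   9) 13 [8], side 18 11, child 11, lat none 13 [26], lat (some 9) 4 [5]],
  [down none, child 4, down (some 14), child 22, lat (some 14) 16 [30], side 18 7, side 4
   18, lat none 9 [4], child 7, lat (some 14) 11 [31], child 0, side 4 13, child 0, child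
   19, child 5, child 6, side 18 11, child 20, lat (some 6) 15 [6], child 21],
  [down none, child 9, lat none 14 [0], child 24, side 2 16, side 18 7, child 7, lat (some
   2) 11 [13], child 25, side 2 11, child 0, child 3, child 0, child 10, child 5, side 7
   13, side 18 11, child 11, lat (some 6) 15 [17], child 4],
  [child 0, down none, child 2, child 3, child 0, child 4, child 2, child 1, child 0,
   lat (some 19) 5 [28], child 5, child 1, side 14 7, lat none 18 [0], lat (some 4) 17 [4],
   child 1, side 14 8, child 6, child 7, child 8],
  [down none, child 9, lat none 14 [7], child 17, side 2 16, side 18 7, child 7, down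
   (some 9), child 2, side 2 11, child 0, child 18, child 2, child 10, child 5, lat (some
   9) 13 [8], side 18 11, child 11, lat (some 5) 11 [28], lat (some 9) 4 [5]],
  [down none, child 9, lat (some 16) 9 [4], child 24, side 2 16, side 18 7, child 7, lat
   (some 2) 11 [13], child 25, side 2 11, child 0, child 3, child 0, child 10, child 5,
   side 7 13, side 18 11, child 11, lat none 13 [6], child 4],
  [child 0, child 1, child 0, child 1, child 0, child 1, child 0, child 1, child 0,
   child 1, child 0, child 1, child 0, child 1, child 0, child 1, child 0, child 1,
   child 0, child 1]]

/-- The letters `x_i` and `x_i⁻¹` are coded by `2 i` and `2 i + 1`; this is the code of `x_i`. -/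
def base (a : Fin 20) : Fin 20 := Fin.ofNat 20 (2 * (a.val / 2))

def Move.shift (r : Fin 20) : Move → Move
  | child t => child t
  | side h c => side (h + r) (c + r)
  | lat g b ts => lat (g.map (· + r)) (b + r) ts
  | down g => down (g.map (· + r))

/-- The table entry, for letters relative to the last letter of the normal form. -/
def relMove (t : ℕ) (x : Fin 20) : Move := (moveTable.getD t []).getD x.val (.down none)

/-- The type of a normal form together with its last letter up to inversion. -/
abbrev State := ℕ × Fin 20

/-- The effect of right multiplication by `x` on a normal form of state `q`. -/
def move (q : State) (x : Fin 20) : Move := (relMove q.1 (x - q.2)).shift q.2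

/-- The state after appending a letter. -/
def next (q : State) (c : Fin 20) : Option State :=
  match move q c with
  | .child t => some (t, base c)
  | _ => none

/-- The letters `y` with `x y` a letter or trivial, together with these products. -/
def products (x : Fin 20) : List (Fin 20 × Option (Fin 20)) :=
  if x.val % 2 = 0 then
    [(x + 1, none), (x + 14, some (x + 2)), (x + 9, some (x + 7)), (x + 13, some (x + 18))]
  else
    [(x + 19, none), (x + 17, some (x + 12)), (x + 6, some (x + 8)), (x + 1, some (x + 13))]

/-- The product of two letters, if it is a letter or trivial. -/
def mul (x y : Fin 20) : Option (Option (Fin 20)) := (products x).lookup y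

def mulO : Option (Fin 20) → Option (Fin 20) → Option (Option (Fin 20))
  | none, m => some m
  | some g, none => some (some g)
  | some g, some y => mul g y

/-- Right multiplication of a word ending with `a` (of state `q`) by `x`, as right multiplication
of the rest by a letter, followed by appending letters (listed in reverse order). -/
def expand (q : State) (a x : Fin 20) : Option (Fin 20) × List (Fin 20) :=
  match move q x with
  | .child _ => (none, [x, a])
  | .side h c =>
    match move q h with
    | .lat g b _ => (g, [c, b])
    -- A dummy value: by `relMove_side`, the letter `h` of a `side` move is always lateral.
    | _ => (none, [])
  | .lat g b _ => (g, [b])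
  | .down g => (g, [])

/-- The product of a normal form of state `q` by `y` and the letters of `w` (in reverse order), with
`y` replaced as far as possible by appended letters. -/
def nf (q : State) (y : Option (Fin 20)) (w : List (Fin 20)) : Option (Fin 20) × List (Fin 20) :=
  match y with
  | none => (none, w)
  | some y =>
    match move q y with
    | .child _ => (none, w ++ [y])
    | .side h c => (some h, w ++ [c])
    | _ => (some y, w)

/-- The possible states after right multiplication by a trivial or lateral letter. -/
def lats (p : State) : Option (Fin 20) → Option (List State)
  | none => some [p]
  | some g =>
    match move p g with
    | .lat _ b ts => some (ts.map fun t => (t, base b))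
    | _ => none

/-- The state after appending several letters. -/
def nexts (q : State) : List (Fin 20) → Option State
  | [] => some q
  | c :: w => (nexts q w).bind fun r => next r c

/-- The product of a normal form of state `q` with appended letters `w` by a letter `y`, as a
product by a letter followed by appending letters. -/
def symMul (q : State) : List (Fin 20) → Option (Fin 20) →
    Option (Option (Fin 20) × List (Fin 20))
  | [], y => some (nf q y [])
  | c :: w, none => some (none, c :: w)
  | c :: w, some y =>
    match nexts q (c :: w) with
    | none => none
    | some r =>
      match symMul q w (expand r c y).1 with
      | none => none
      | some z => some (z.1, (expand r c y).2 ++ z.2)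

/-- The table entries for a normal form of state `q` with parent of state `p` are consistent. -/
def latCheck (p q : State) (x : Fin 20) : Bool :=
  match move q x with
  | .child _ => true
  | .side h c =>
    match move q h with
    | .lat _ b ts => ts.all fun t => (next (t, base b) c).isSome
    | _ => false
  | .lat g b ts =>
    match lats p g with
    | some l => l.all fun r => match next r b with
      | some r' => ts.elem r'.1
      | none => false
    | none => false
  | .down g => (lats p g).isSome

/-- The relations starting with `x` hold at a normal form of state `q` with last letter `a` and
parent of state `p`, provided that they hold at the parent. -/
def mulCheck (p q : State) (a x : Fin 20) : Bool :=
  let e := expand q a x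
  match lats p e.1 with
  | none => false
  | some l =>
    l.all fun r => (products x).all fun yz =>
      match symMul r e.2 (some yz.1) with
      | none => false
      | some s =>
        match mulO e.1 s.1 with
        | none => false
        | some m =>
          match yz.2 with
          | none => decide (nf p m s.2 = (none, [a]))
          | some z => decide (nf p m s.2 = nf p (expand q a z).1 (expand q a z).2)

def letters : List (Fin 20) :=
  [0, 1, 2, 3, 4, 5, 6, 7, 8, 9, 10, 11, 12, 13, 14, 15, 16, 17, 18, 19]

/-- A check for all normal forms, up to shifts, whose parent has type `t`. -/
def parentCheck (f : State → State → Fin 20 → Fin 20 → Bool) (t : ℕ) : Bool :=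
  [0, 2, 4, 6, 8, 10, 12, 14, 16, 18].all fun k => [0, 1].all fun a =>
    match next (t, k) a with
    | none => true
    | some q => letters.all (f (t, k) q a)

/-! ### Finite computations on the table. -/

theorem latCheck_all : ∀ t : Fin 34, parentCheck (fun p q _ => latCheck p q) t = true := by
  decide +kernel

/-- This computation is the inductive step of `act_act`: it certifies that the table respects the
relations of the group. -/
theorem mulCheck_all : ∀ t : Fin 34, parentCheck mulCheck t = true := by
  decide +kernel

theorem all_mem_products : ∀ x y : Fin 20,
    (mul x y).all (fun z => decide ((y, z) ∈ products x)) = true := by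
  decide +kernel

theorem mem_products {x y : Fin 20} {z : Option (Fin 20)} (h : mul x y = some z) :
    (y, z) ∈ products x := by
  simpa [h] using all_mem_products x y

/-- The condition `base r = r` says that `r` is even, so that adding `r` shifts indices and
preserves signs. -/
theorem mul_shift : ∀ r x y : Fin 20, base r = r →
    mul (x + r) (y + r) = (mul x y).map (Option.map (· + r)) := by
  decide +kernel

theorem base_add : ∀ x r : Fin 20, base r = r → base (x + r) = base x + r := by
  decide +kernel

def Move.isLat : Move → Bool
  | lat _ _ _ => true
  | _ => false

def Move.sideLetter : Move → Option (Fin 20)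
  | side h _ => some h
  | _ => none

theorem relMove_side_all : ∀ t : Fin 34, ∀ x : Fin 20,
    ((relMove t x).sideLetter.all fun h => (relMove t h).isLat) = true := by
  decide +kernel

theorem relMove_of_le {t : ℕ} (ht : 34 ≤ t) (x : Fin 20) : relMove t x = .down none := by
  have : moveTable.length = 34 := rfl
  simp [relMove, this, ht]

theorem relMove_side {t : ℕ} {x h c : Fin 20} (hx : relMove t x = .side h c) :
    ∃ g b ts, relMove t h = .lat g b ts := by
  by_cases ht : t < 34
  · have := relMove_side_all ⟨t, ht⟩ x
    rw [hx] at this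
    simp only [Move.sideLetter, Option.all_some] at this
    cases hm : relMove t h <;> simp [hm, Move.isLat] at this
    exact ⟨_, _, _, rfl⟩
  · simp [relMove_of_le (not_lt.mp ht)] at hx

theorem relMove_root : ∀ x : Fin 20, relMove 33 x = .child (x.val % 2) := by
  decide +kernel

/-! ### Shifting indices -/

theorem Move.shift_add (r s : Fin 20) (m : Move) : m.shift (r + s) = (m.shift r).shift s := by
  cases m <;> simp [Move.shift, add_assoc, Function.comp_def]

theorem move_shift (t : ℕ) (k r x : Fin 20) :
    move (t, k + r) (x + r) = (move (t, k) x).shift r := by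
  simp [move, Move.shift_add]

theorem move_side {q : State} {x h c : Fin 20} (hx : move q x = .side h c) :
    ∃ g b ts, move q h = .lat g b ts := by
  unfold move at hx ⊢
  cases hm : relMove q.1 (x - q.2) <;> rw [hm] at hx <;> simp only [Move.shift, reduceCtorEq] at hx
  rename_i h' c'
  obtain ⟨g, b, ts, h2⟩ := relMove_side hm
  simp only [Move.side.injEq] at hx
  rw [← hx.1, add_sub_cancel_right, h2]
  exact ⟨_, _, _, rfl⟩

theorem move_root_shift (x r : Fin 20) (hr : base r = r) :
    move (33, 0) (x + r) = (move (33, 0) x).shift r := by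
  simp only [move, relMove_root, Move.shift, sub_zero]
  have : ∀ x r : Fin 20, base r = r → (x + r).val % 2 = x.val % 2 := by decide +kernel
  rw [this x r hr]

/-! ### Normal forms and the right action of a letter. -/

/-- Words in the letters; every letter carries the type of the prefix ending with it. The last
letter is the head of the list. -/
abbrev Word := List (Fin 20 × ℕ)

def state : Word → State
  | [] => (33, 0)
  | e :: _ => (e.2, base e.1)

/-- Append a letter. -/
def push (c : Fin 20) (u : Word) : Word :=
  match move (state u) c with
  | .child t => (c, t) :: u
  -- A dummy value: `latCheck` ensures that `act`, applied to a normal form, pushes only letters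
  -- with a `child` move.
  | _ => u

def pushAll (w : List (Fin 20)) (u : Word) : Word := w.foldr push u

/-- Right multiplication of a normal form by a letter. -/
def act (x : Fin 20) : Word → Word
  | [] => push x []
  | e :: u =>
    pushAll (expand (state (e :: u)) e.1 x).2
      ((expand (state (e :: u)) e.1 x).1.elim u fun y => act y u)

def actO (g : Option (Fin 20)) (u : Word) : Word := g.elim u fun y => act y u

theorem act_cons (x : Fin 20) (e : Fin 20 × ℕ) (u : Word) :
    act x (e :: u) = pushAll (expand (e.2, base e.1) e.1 x).2
      (actO (expand (e.2, base e.1) e.1 x).1 u) := rfl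

/-- The words which are normal forms. -/
def Valid : Word → Prop
  | [] => True
  | e :: u => move (state u) e.1 = .child e.2 ∧ Valid u

/-- The normal form with the indices of all letters shifted. -/
def shift (r : Fin 20) (u : Word) : Word := u.map fun e => (e.1 + r, e.2)

theorem shift_shift (r s : Fin 20) (u : Word) : shift s (shift r u) = shift (r + s) u := by
  simp [shift, Function.comp_def, add_assoc]

theorem shift_zero (u : Word) : shift 0 u = u := by simp [shift]

theorem length_shift (r : Fin 20) (u : Word) : (shift r u).length = u.length := by simp [shift]

theorem base_neg : ∀ r : Fin 20, base r = r → base (-r) = -r := by decide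

theorem base_base : ∀ a : Fin 20, base (base a) = base a := by decide

section
variable {r : Fin 20} (hr : base r = r)
include hr

theorem move_state_shift (u : Word) (x : Fin 20) :
    move (state (shift r u)) (x + r) = (move (state u) x).shift r := by
  cases u with
  | nil => exact move_root_shift x r hr
  | cons e u => simp only [shift, state, List.map_cons, base_add _ _ hr, move_shift]

theorem push_shift (c : Fin 20) (u : Word) : push (c + r) (shift r u) = shift r (push c u) := by
  unfold push
  rw [move_state_shift hr]
  cases move (state u) c <;> rfl

theorem pushAll_shift (w : List (Fin 20)) (u : Word) :
    pushAll (w.map (· + r)) (shift r u) = shift r (pushAll w u) := by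
  induction w with
  | nil => rfl
  | cons c w ih => simp only [pushAll, List.map_cons, List.foldr_cons] at ih ⊢
                   rw [ih, push_shift hr]

omit hr in
theorem expand_shift (t : ℕ) (k a x : Fin 20) :
    expand (t, k + r) (a + r) (x + r) =
      ((expand (t, k) a x).1.map (· + r), (expand (t, k) a x).2.map (· + r)) := by
  unfold expand
  rw [move_shift]
  cases hm : move (t, k) x with
  | side h c =>
    simp only [Move.shift, move_shift]
    cases move (t, k) h <;> rfl
  | _ => rfl

theorem act_shift (x : Fin 20) (u : Word) : act (x + r) (shift r u) = shift r (act x u) := by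
  induction u generalizing x with
  | nil => exact push_shift hr x []
  | cons e u ih =>
    rw [show shift r (e :: u) = (e.1 + r, e.2) :: shift r u from rfl, act_cons, act_cons,
      base_add _ _ hr, expand_shift, ← pushAll_shift hr]
    congr 1
    cases (expand (e.2, base e.1) e.1 x).1 with
    | none => rfl
    | some g => exact ih g

theorem actO_shift (g : Option (Fin 20)) (u : Word) :
    actO (g.map (· + r)) (shift r u) = shift r (actO g u) := by
  cases g with
  | none => rfl
  | some g => exact act_shift hr g u

theorem Valid.shift {u : Word} (hu : Valid u) : Valid (shift r u) := by
  induction u with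
  | nil => trivial
  | cons e u ih =>
    refine ⟨?_, ih hu.2⟩
    change move (state (GilbertHowie.shift r u)) (e.1 + r) = _
    rw [move_state_shift hr, hu.1]
    rfl

end

theorem sub_base_mem : ∀ a : Fin 20, a - base a ∈ ([0, 1] : List (Fin 20)) := by decide

/-- Induction on normal forms for properties which are invariant under shifts of the indices. -/
theorem valid_induction {P : Word → Prop}
    (hshift : ∀ r u, base r = r → P u → P (shift r u)) (nil : P [])
    (cons : ∀ a t u, a ∈ ([0, 1] : List (Fin 20)) → Valid ((a, t) :: u) → P u → P ((a, t) :: u))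
    (u : Word) (hu : Valid u) : P u := by
  induction u with
  | nil => exact nil
  | cons e u ih =>
    have hb := base_neg _ (base_base e.1)
    -- Shifting makes the last letter `0` or `1`, the only cases covered by `cons`; the shift is
    -- undone afterwards.
    have h : P (shift (-base e.1) (e :: u)) := by
      refine cons (e.1 + -base e.1) e.2 (shift (-base e.1) u) ?_ (Valid.shift hb hu)
        (hshift _ _ hb (ih hu.2))
      rw [← sub_eq_add_neg]
      exact sub_base_mem e.1
    have := hshift _ _ (base_base e.1) h
    rwa [shift_shift, neg_add_cancel, shift_zero] at this

theorem base_mem : ∀ a : Fin 20,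
    base a ∈ ([0, 2, 4, 6, 8, 10, 12, 14, 16, 18] : List (Fin 20)) := by decide

theorem mem_letters : ∀ a : Fin 20, a ∈ letters := by decide

theorem parentCheck_spec {f : State → State → Fin 20 → Fin 20 → Bool}
    (hf : ∀ t : Fin 34, parentCheck f t = true) {a : Fin 20} {t : ℕ} {u : Word}
    (ha : a ∈ ([0, 1] : List (Fin 20))) (hu : Valid ((a, t) :: u)) (x : Fin 20) :
    f (state u) (t, base a) a x = true := by
  have hk : (state u).2 ∈ ([0, 2, 4, 6, 8, 10, 12, 14, 16, 18] : List (Fin 20)) := by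
    cases u with
    | nil => decide
    | cons e u => exact base_mem e.1
  -- Rows outside the table default to `.down none`, so a word of such a type has no children.
  have ht : (state u).1 < 34 := by
    by_contra h
    have := hu.1
    simp [move, relMove_of_le (not_lt.mp h), Move.shift] at this
  have h := hf ⟨_, ht⟩
  unfold parentCheck at h
  rw [List.all_eq_true] at h
  have h1 := h _ hk
  rw [List.all_eq_true] at h1
  have h2 := h1 _ ha
  have hn : next (state u) a = some (t, base a) := by
    unfold next
    rw [hu.1]
  simp only [hn] at h2
  rw [List.all_eq_true] at h2
  exact h2 x (mem_letters x)

/-! ### Soundness of the symbolic computations -/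

theorem next_eq_some {q r : State} {c : Fin 20} (h : next q c = some r) :
    ∃ t, move q c = .child t ∧ r = (t, base c) := by
  unfold next at h
  cases hm : move q c <;> simp only [hm, reduceCtorEq, Option.some.injEq] at h
  exact ⟨_, rfl, h.symm⟩

theorem push_of_child {u : Word} {c : Fin 20} {t : ℕ} (h : move (state u) c = .child t) :
    push c u = (c, t) :: u := by
  simp only [push, h]

theorem push_spec {u : Word} (hu : Valid u) {c : Fin 20} {r : State}
    (h : next (state u) c = some r) :
    Valid (push c u) ∧ (push c u).length = u.length + 1 ∧ state (push c u) = r := by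
  obtain ⟨t, ht, rfl⟩ := next_eq_some h
  rw [push_of_child ht]
  exact ⟨⟨ht, hu⟩, rfl, rfl⟩

theorem pushAll_spec {u : Word} (hu : Valid u) {w : List (Fin 20)} {r : State}
    (h : nexts (state u) w = some r) : Valid (pushAll w u) ∧ state (pushAll w u) = r := by
  induction w generalizing r with
  | nil => exact ⟨hu, Option.some.inj h⟩
  | cons c w ih =>
    obtain ⟨s, hs, hr⟩ := Option.bind_eq_some_iff.mp h
    obtain ⟨h1, h2⟩ := ih hs
    rw [← h2] at hr
    exact ⟨(push_spec h1 hr).1, (push_spec h1 hr).2.2⟩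

theorem move_root (x : Fin 20) : move (state []) x = .child (x.val % 2) := by
  simp [state, move, relMove_root, Move.shift]

/-- For a nonempty word, `act` strips the last letter and pushes it back before pushing `x`;
validity returns the same type tag. -/
theorem act_child {u : Word} (hu : Valid u) {x : Fin 20} {t : ℕ}
    (h : move (state u) x = .child t) : act x u = push x u := by
  cases u with
  | nil => rfl
  | cons e u =>
    have h' : move (e.2, base e.1) x = .child t := h
    rw [act_cons]
    simp only [expand, h']
    change push x (push e.1 u) = _
    rw [push_of_child hu.1]

theorem act_side {u : Word} {x h c : Fin 20} (hx : move (state u) x = .side h c) :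
    act x u = push c (act h u) := by
  cases u with
  | nil => simp [move_root] at hx
  | cons e u =>
    obtain ⟨g, b, ts, hh⟩ := move_side hx
    have hx' : move (e.2, base e.1) x = .side h c := hx
    have hh' : move (e.2, base e.1) h = .lat g b ts := hh
    rw [act_cons, act_cons]
    simp only [expand, hx', hh']
    rfl

/-! ### Lateral moves and the bound on the growth of length. -/

/-- Lateral multiplications preserve the length of a normal form. -/
def IsLateral (u : Word) : Prop := ∀ x g b ts, move (state u) x = .lat g b ts →
  Valid (act x u) ∧ (act x u).length = u.length ∧ ∃ t ∈ ts, state (act x u) = (t, base b)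

theorem IsLateral.actO_spec {u : Word} (h : IsLateral u) (hu : Valid u) {g : Option (Fin 20)}
    {l : List State} (hl : lats (state u) g = some l) :
    Valid (actO g u) ∧ (actO g u).length = u.length ∧ state (actO g u) ∈ l := by
  cases g with
  | none =>
    simp only [lats, Option.some.injEq] at hl
    exact ⟨hu, rfl, by simp [← hl, actO]⟩
  | some x =>
    unfold lats at hl
    cases hm : move (state u) x <;> simp only [hm, reduceCtorEq, Option.some.injEq] at hl
    obtain ⟨h1, h2, t, ht, h3⟩ := h x _ _ _ hm
    refine ⟨h1, h2, ?_⟩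
    rw [← hl]
    exact List.mem_map.mpr ⟨t, ht, h3.symm⟩

theorem state_shift {u : Word} (hu : u ≠ []) (r : Fin 20) (hr : base r = r) :
    state (shift r u) = ((state u).1, (state u).2 + r) := by
  cases u with
  | nil => exact absurd rfl hu
  | cons e u => simp [shift, state, base_add _ _ hr]

theorem IsLateral.shift {r : Fin 20} {u : Word} (hr : base r = r) (h : IsLateral u) :
    IsLateral (shift r u) := by
  intro x g b ts hx
  obtain ⟨y, rfl⟩ : ∃ y, x = y + r := ⟨x - r, by simp⟩
  rw [move_state_shift hr] at hx
  cases hm : move (state u) y <;> simp only [hm, Move.shift, reduceCtorEq, Move.lat.injEq] at hx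
  obtain ⟨h1, h2, t, ht, h3⟩ := h y _ _ _ hm
  have hne : act y u ≠ [] := by
    intro h0
    rw [h0, List.length_nil] at h2
    rw [List.length_eq_zero_iff.mp h2.symm, move_root] at hm
    simp at hm
  rw [act_shift hr]
  refine ⟨Valid.shift hr h1, by simp only [length_shift, h2], t, hx.2.2 ▸ ht, ?_⟩
  rw [state_shift hne r hr, h3, ← hx.2.1, base_add _ _ hr]

/-- A lateral move turns ua into (ug)b. By `latCheck`, `g` is trivial or lateral at u, so induction
gives the length of ug and a finite list of its possible states; from each of these, `b` is a child
with a type in `ts`. -/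
theorem isLateral {u : Word} (hu : Valid u) : IsLateral u := by
  refine valid_induction (fun r u hr => IsLateral.shift hr) ?_ ?_ u hu
  · intro x g b ts hx
    simp [move_root] at hx
  · intro a t u ha hu ih x g b ts hx
    have hc := parentCheck_spec latCheck_all ha hu x
    have hx' : move (t, base a) x = .lat g b ts := hx
    simp only [latCheck, hx'] at hc
    rw [act_cons]
    simp only [expand, hx']
    cases hl : lats (state u) g with
    | none => simp [hl] at hc
    | some l =>
      obtain ⟨h1, h2, h3⟩ := ih.actO_spec hu.2 hl
      simp only [hl, List.all_eq_true] at hc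
      have hc := hc _ h3
      cases hn : next (state (actO g u)) b with
      | none => simp [hn] at hc
      | some r =>
        obtain ⟨k1, k2, k3⟩ := push_spec h1 hn
        obtain ⟨t', -, rfl⟩ := next_eq_some hn
        simp only [hn, List.elem_eq_mem, decide_eq_true_eq] at hc
        exact ⟨k1, by simp [pushAll, k2, h2], t', hc, k3⟩

theorem act_spec {u : Word} (hu : Valid u) (x : Fin 20) :
    Valid (act x u) ∧ (act x u).length ≤ u.length + 1 := by
  revert x
  refine valid_induction (P := fun u => ∀ x, Valid (act x u) ∧ (act x u).length ≤ u.length + 1)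
    ?_ ?_ ?_ u hu
  · intro r u hr h x
    obtain ⟨y, rfl⟩ : ∃ y, x = y + r := ⟨x - r, by simp⟩
    rw [act_shift hr, length_shift, length_shift]
    exact ⟨Valid.shift hr (h y).1, (h y).2⟩
  · intro x
    rw [act_child (u := []) trivial (move_root x), push_of_child (move_root x)]
    exact ⟨⟨move_root x, trivial⟩, le_rfl⟩
  · intro a t u ha hu _ x
    have hc := parentCheck_spec latCheck_all ha hu x
    unfold latCheck at hc
    cases hm : move (state ((a, t) :: u)) x with
    | child t' =>
      rw [act_child hu hm, push_of_child hm]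
      exact ⟨⟨hm, hu⟩, le_rfl⟩
    | side h c =>
      have hm' : move (t, base a) x = .side h c := hm
      obtain ⟨g, b, ts, hh⟩ := move_side hm
      have hh' : move (t, base a) h = .lat g b ts := hh
      simp only [hm', hh', List.all_eq_true] at hc
      obtain ⟨h1, h2, t', ht, h3⟩ := isLateral hu _ _ _ _ hh
      obtain ⟨r, hr⟩ := Option.isSome_iff_exists.mp (hc t' ht)
      rw [← h3] at hr
      rw [act_side hm]
      obtain ⟨k1, k2, k3⟩ := push_spec h1 hr
      exact ⟨k1, by omega⟩
    | lat g b ts =>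
      obtain ⟨h1, h2, -⟩ := isLateral hu _ _ _ _ hm
      exact ⟨h1, by omega⟩
    | down g =>
      have hm' : move (t, base a) x = .down g := hm
      simp only [hm'] at hc
      obtain ⟨l, hl⟩ := Option.isSome_iff_exists.mp hc
      obtain ⟨h1, h2, -⟩ := (isLateral hu.2).actO_spec hu.2 hl
      rw [act_cons]
      simp only [expand, hm']
      exact ⟨h1, by simp [pushAll, h2]; omega⟩

/-- `nf` unfolds only the `child` and `side` moves, whose effect is a push by `act_child` and
`act_side`; other letters stay as they are. -/
theorem pushAll_nf {u : Word} (hu : Valid u) (y : Option (Fin 20)) (w : List (Fin 20)) :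
    pushAll (nf (state u) y w).2 (actO (nf (state u) y w).1 u) = pushAll w (actO y u) := by
  cases y with
  | none => rfl
  | some y =>
    unfold nf
    cases hm : move (state u) y with
    | child t => simp [pushAll, actO, hm, act_child hu hm]
    | side h c => simp [pushAll, actO, hm, act_side hm]
    | lat g b ts => simp [hm]
    | down g => simp [hm]

theorem pushAll_symMul {u : Word} (hu : Valid u) {w : List (Fin 20)} {y : Option (Fin 20)}
    {z : Option (Fin 20) × List (Fin 20)} (h : symMul (state u) w y = some z) :
    actO y (pushAll w u) = pushAll z.2 (actO z.1 u) := by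
  induction w generalizing y z with
  | nil =>
    simp only [symMul, Option.some.injEq] at h
    rw [← h, pushAll_nf hu]
    rfl
  | cons c w ih =>
    cases y with
    | none =>
      simp only [symMul, Option.some.injEq] at h
      rw [← h]
      rfl
    | some y =>
      unfold symMul at h
      cases hn : nexts (state u) (c :: w) with
      | none => simp [hn] at h
      | some r =>
        simp only [hn] at h
        cases hs : symMul (state u) w (expand r c y).1 with
        | none => simp [hs] at h
        | some z' =>
          simp only [hs, Option.some.injEq] at h
          obtain ⟨s, hs', hr⟩ := Option.bind_eq_some_iff.mp hn
          obtain ⟨t, ht, rfl⟩ := next_eq_some hr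
          rw [← (pushAll_spec hu hs').2] at ht
          have hp : pushAll (c :: w) u = (c, t) :: pushAll w u := push_of_child ht
          rw [hp]
          change act y _ = _
          rw [act_cons, ih hs, ← h]
          simp [pushAll]

/-! ### The triangle relations hold for the action. -/

theorem act_act_nil : ∀ x y : Fin 20,
    (mul x y).all (fun z => decide (act y (act x []) = actO z [])) = true := by
  decide +kernel

/-- Both sides are rewritten as one letter acting on the parent followed by pushes. The two letters
that reach the parent on the left are merged there by the induction hypothesis, and `mulCheck` then
compares the two symbolic expressions. -/
theorem act_act {u : Word} (hu : Valid u) {x y : Fin 20} {z : Option (Fin 20)}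
    (h : mul x y = some z) : act y (act x u) = actO z u := by
  revert x y z
  refine valid_induction
    (P := fun u => ∀ {x y : Fin 20} {z : Option (Fin 20)},
      mul x y = some z → act y (act x u) = actO z u) ?_ ?_ ?_ u hu
  · intro r u hr h x y z hz
    obtain ⟨x, rfl⟩ : ∃ x', x = x' + r := ⟨x - r, by simp⟩
    obtain ⟨y, rfl⟩ : ∃ y', y = y' + r := ⟨y - r, by simp⟩
    rw [mul_shift r x y hr] at hz
    obtain ⟨z, hz', rfl⟩ := Option.map_eq_some_iff.mp hz
    rw [act_shift hr, act_shift hr, actO_shift hr, h hz']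
  · intro x y z hz
    simpa [hz] using act_act_nil x y
  · intro a t u ha hu ih x y z hz
    have hc := parentCheck_spec mulCheck_all ha hu x
    have ihO : ∀ {g m : Option (Fin 20)} {k}, mulO g m = some k → actO m (actO g u) = actO k u := by
      intro g m k hk
      cases g with
      | none =>
        simp only [mulO, Option.some.injEq] at hk
        rw [hk]; rfl
      | some g =>
        cases m with
        | none =>
          simp only [mulO, Option.some.injEq] at hk
          rw [← hk]; rfl
        | some m => exact ih hk
    have hpush : pushAll [a] u = (a, t) :: u := push_of_child hu.1
    unfold mulCheck at hc
    cases hl : lats (state u) (expand (t, base a) a x).1 with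
    | none => simp [hl] at hc
    | some l =>
      obtain ⟨h1, -, h3⟩ := (isLateral hu.2).actO_spec hu.2 hl
      simp only [hl, List.all_eq_true] at hc
      have hc := hc _ h3 _ (mem_products hz)
      cases hs : symMul (state (actO (expand (t, base a) a x).1 u)) (expand (t, base a) a x).2
        (some y) with
      | none => simp [hs] at hc
      | some s =>
        simp only [hs] at hc
        cases hm : mulO (expand (t, base a) a x).1 s.1 with
        | none => simp [hm] at hc
        | some m =>
          simp only [hm] at hc
          have key : act y (act x ((a, t) :: u)) =
              pushAll (nf (state u) m s.2).2 (actO (nf (state u) m s.2).1 u) := by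
            rw [act_cons, pushAll_nf hu.2, ← ihO hm]
            exact pushAll_symMul h1 hs
          rw [key]
          cases z with
          | none =>
            simp only [decide_eq_true_eq] at hc
            rw [hc]
            exact hpush
          | some z =>
            simp only [decide_eq_true_eq] at hc
            rw [hc, pushAll_nf hu.2]
            rfl

/-! ### Words along which the length grows -/

/-- The possible states after right multiplication by a letter, `none` if the length might fail to
increase. -/
def ups (q : State) (x : Fin 20) : List (Option State) :=
  match move q x with
  | .child t => [some (t, base x)]
  | .side h c =>
    match move q h with
    | .lat _ b ts => ts.map fun t => next (t, base b) c
    | _ => [none]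
  | _ => [none]

/-- The possible states after right multiplication by a word. -/
def run : List (Fin 20) → State → List (Option State)
  | [], q => [some q]
  | x :: w, q => (ups q x).flatMap fun r => r.elim [none] (run w)

def actWord (w : List (Fin 20)) (u : Word) : Word := w.foldl (fun u x => act x u) u

theorem ups_spec {u : Word} (hu : Valid u) {x : Fin 20} (h : none ∉ ups (state u) x) :
    (act x u).length = u.length + 1 ∧ some (state (act x u)) ∈ ups (state u) x := by
  unfold ups at h ⊢
  cases hm : move (state u) x with
  | child t =>
    rw [act_child hu hm, push_of_child hm]
    exact ⟨rfl, by simp [state]⟩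
  | side k c =>
    obtain ⟨g, b, ts, hh⟩ := move_side hm
    obtain ⟨h1, h2, t', ht, h3⟩ := isLateral hu _ _ _ _ hh
    simp only [hm, hh] at h ⊢
    cases hn : next (t', base b) c with
    | none => exact absurd (List.mem_map.mpr ⟨t', ht, hn⟩) h
    | some r =>
      obtain ⟨-, k2, k3⟩ := push_spec h1 (h3 ▸ hn)
      rw [act_side hm, k3, k2, h2]
      exact ⟨rfl, List.mem_map.mpr ⟨t', ht, hn⟩⟩
  | lat g b ts => simp [hm] at h
  | down g => simp [hm] at h

theorem actWord_valid {u : Word} (hu : Valid u) (w : List (Fin 20)) : Valid (actWord w u) := by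
  induction w generalizing u with
  | nil => exact hu
  | cons x w ih => exact ih (act_spec hu x).1

theorem run_spec {u : Word} (hu : Valid u) {w : List (Fin 20)} (h : none ∉ run w (state u)) :
    (actWord w u).length = u.length + w.length ∧
      some (state (actWord w u)) ∈ run w (state u) := by
  induction w generalizing u with
  | nil => exact ⟨rfl, by simp [run, actWord]⟩
  | cons x w ih =>
    simp only [run, List.mem_flatMap, not_exists, not_and] at h ⊢
    have h0 : none ∉ ups (state u) x := fun h0 => h none h0 (by simp)
    obtain ⟨h1, h2⟩ := ups_spec hu h0
    obtain ⟨h3, h4⟩ := ih (act_spec hu x).1 (h _ h2)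
    exact ⟨by simp only [actWord, List.foldl_cons, List.length_cons] at h3 ⊢; omega, _, h2, h4⟩

/-- Multiplication by `w` takes normal forms with states in `Q` to normal forms with states in `R`
which are longer by the length of `w`. -/
def rises (w : List (Fin 20)) (Q R : List State) : Bool :=
  Q.all fun q => (run w q).all fun r => r.elim false R.elem

theorem rises_spec {w : List (Fin 20)} {Q R : List State} (h : rises w Q R = true) {u : Word}
    (hu : Valid u) (hq : state u ∈ Q) :
    (actWord w u).length = u.length + w.length ∧ state (actWord w u) ∈ R := by
  simp only [rises, List.all_eq_true] at h
  have h := h _ hq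
  obtain ⟨h1, h2⟩ := run_spec hu (w := w) (fun h0 => by simpa using h _ h0)
  exact ⟨h1, by simpa using h _ h2⟩

/-! ### The action of the group on normal forms -/

def invLetter (x : Fin 20) : Fin 20 := if x.val % 2 = 0 then x + 1 else x - 1

theorem invLetter_invLetter : ∀ x, invLetter (invLetter x) = x := by decide

theorem mul_invLetter : ∀ x, mul x (invLetter x) = some none := by decide +kernel

/-- Right multiplication by a letter as a permutation of the set of normal forms. -/
def perm (x : Fin 20) : Equiv.Perm {u : Word // Valid u} where
  toFun u := ⟨act x u.1, (act_spec u.2 x).1⟩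
  invFun u := ⟨act (invLetter x) u.1, (act_spec u.2 _).1⟩
  left_inv u := Subtype.ext (act_act u.2 (mul_invLetter x))
  right_inv u := by
    have h := mul_invLetter (invLetter x)
    rw [invLetter_invLetter] at h
    exact Subtype.ext (act_act u.2 h)

theorem perm_invLetter (x : Fin 20) : perm (invLetter x) = (perm x)⁻¹ := by
  ext u : 1
  rfl

/-- The letter `x_i`. -/
def letter (i : ZMod 10) : Fin 20 := Fin.ofNat 20 (2 * i.val)

theorem mul_letter : ∀ i : ZMod 10,
    mul (letter i) (letter (i + (7 : ℕ))) = some (some (letter (i + (1 : ℕ)))) := by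
  decide +kernel

/-- The right action of `H(10,7)` on the normal forms. -/
def rep : GilbertHowieGroup 10 7 →* (Equiv.Perm {u : Word // Valid u})ᵐᵒᵖ :=
  PresentedGroup.toGroup (f := fun i => MulOpposite.op (perm (letter i))) (by
    rintro _ ⟨i, rfl⟩
    simp only [map_mul, map_inv, FreeGroup.lift_apply_of]
    rw [mul_inv_eq_one, ← MulOpposite.op_mul]
    congr 1
    ext u : 1
    exact Subtype.ext (act_act u.2 (mul_letter i)))

/-- The right action of a group element on a normal form. -/
def rmul (g : GilbertHowieGroup 10 7) (u : {u : Word // Valid u}) : {u : Word // Valid u} :=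
  (rep g).unop u

theorem rmul_one (u) : rmul 1 u = u := by simp [rmul]

theorem rmul_mul (g h : GilbertHowieGroup 10 7) (u) : rmul (g * h) u = rmul h (rmul g u) := by
  simp [rmul]

/-- The group element represented by a letter. -/
def elt (x : Fin 20) : GilbertHowieGroup 10 7 :=
  if x.val % 2 = 0 then GilbertHowieGroup.x (x.val / 2 : ℕ)
  else (GilbertHowieGroup.x (x.val / 2 : ℕ))⁻¹

theorem letter_even : ∀ x : Fin 20, x.val % 2 = 0 → letter (x.val / 2 : ℕ) = x := by decide

theorem letter_odd : ∀ x : Fin 20, x.val % 2 ≠ 0 →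
    invLetter (letter (x.val / 2 : ℕ)) = x := by decide

theorem rep_x (i : ZMod 10) :
    rep (GilbertHowieGroup.x i) = MulOpposite.op (perm (letter i)) :=
  PresentedGroup.toGroup.of _

theorem rmul_elt (x : Fin 20) (u) : (rmul (elt x) u).1 = act x u.1 := by
  unfold rmul elt
  split
  · next h =>
    rw [rep_x, letter_even x h]
    rfl
  · next h =>
    rw [map_inv, rep_x, ← MulOpposite.op_inv, ← perm_invLetter, letter_odd x h]
    rfl

theorem rmul_prod (w : List (Fin 20)) (u) : (rmul (w.map elt).prod u).1 = actWord w u.1 := by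
  induction w generalizing u with
  | nil => simp [rmul_one, actWord]
  | cons x w ih => simp [rmul_mul, ih, actWord, rmul_elt]

/-- The length of the normal form of an element. -/
def len (g : GilbertHowieGroup 10 7) : ℕ := (rmul g ⟨[], trivial⟩).1.length

theorem len_one : len 1 = 0 := by simp [len, rmul_one]

theorem len_prod (w : List (Fin 20)) : len (w.map elt).prod = (actWord w []).length := by
  rw [len, rmul_prod]

theorem exists_length_rmul_le (s : GilbertHowieGroup 10 7) :
    ∃ C, ∀ u, (rmul s u).1.length ≤ u.1.length + C := by
  obtain ⟨z, rfl⟩ := PresentedGroup.mk_surjective _ s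
  induction z using FreeGroup.induction_on with
  | C1 => exact ⟨0, fun u => by rw [map_one, rmul_one]; rfl⟩
  | of i =>
    refine ⟨1, fun u => ?_⟩
    have h : rmul (GilbertHowieGroup.x i) u = perm (letter i) u := by rw [rmul, rep_x]; rfl
    exact (congrArg (fun v => v.1.length) h).trans_le (act_spec u.2 _).2
  | inv_of i _ =>
    refine ⟨1, fun u => ?_⟩
    have h : rmul (GilbertHowieGroup.x i)⁻¹ u = perm (invLetter (letter i)) u := by
      rw [rmul, map_inv, rep_x, perm_invLetter]; rfl
    exact (congrArg (fun v => v.1.length) h).trans_le (act_spec u.2 _).2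
  | mul x y hx hy =>
    obtain ⟨C, hC⟩ := hx
    obtain ⟨D, hD⟩ := hy
    refine ⟨C + D, fun u => ?_⟩
    rw [map_mul, rmul_mul]
    have := hC u
    have := hD (rmul (PresentedGroup.mk _ x) u)
    omega

theorem exists_len_mul_le (s : GilbertHowieGroup 10 7) : ∃ C, ∀ g, len (g * s) ≤ len g + C := by
  obtain ⟨C, hC⟩ := exists_length_rmul_le s
  exact ⟨C, fun g => by rw [len, rmul_mul]; exact hC _⟩

/-- If the words `w k` may follow each other along the pairs of a relation `r`, in the sense that
multiplication by `w k` increases lengths by `2` from the states `Q j` with `r j k`, then products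
of such words are as long as the words. -/
theorem actWord_flatMap {κ : Type*} {r : κ → κ → Prop} {w : κ → List (Fin 20)} {Q : κ → List State}
    {n : ℕ} (hw : ∀ k, (w k).length = n) (h0 : ∀ k, rises (w k) [(33, 0)] (Q k) = true)
    (hr : ∀ j k, r j k → rises (w k) (Q j) (Q k) = true) {l : List κ} (hl : l.IsChain r) :
    (actWord (l.flatMap w) []).length = n * l.length := by
  -- The list `Q j` for the preceding word `j` is all the memory that the induction needs.
  have key : ∀ l : List κ, ∀ j u, (j :: l).IsChain r → Valid u → state u ∈ Q j →
      (actWord (l.flatMap w) u).length = u.length + n * l.length := by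
    intro l
    induction l with
    | nil => intro j u _ _ _; simp [actWord]
    | cons k l ih =>
      intro j u hl hu hs
      rw [List.isChain_cons_cons] at hl
      obtain ⟨h1, h2⟩ := rises_spec (hr j k hl.1) hu hs
      have h3 := ih k _ hl.2 (actWord_valid hu _) h2
      rw [List.flatMap_cons, actWord, List.foldl_append]
      change (actWord _ (actWord (w k) u)).length = _
      rw [h3, h1, hw, List.length_cons]
      ring
  cases l with
  | nil => simp [actWord]
  | cons k l =>
    obtain ⟨h1, h2⟩ := rises_spec (h0 k) (u := []) trivial (by simp [state])
    have h3 := key l k _ hl (actWord_valid (u := []) trivial _) h2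
    rw [List.flatMap_cons, actWord, List.foldl_append]
    change (actWord _ (actWord (w k) [])).length = _
    rw [h3, h1, hw, List.length_cons, List.length_nil]
    ring

theorem len_pow {w : List (Fin 20)} {Q : List State} (h0 : rises w [(33, 0)] Q = true)
    (h : rises w Q Q = true) (n : ℕ) : len ((w.map elt).prod ^ n) = w.length * n := by
  have h1 := actWord_flatMap (κ := Unit) (r := fun _ _ => True) (w := fun _ => w) (Q := fun _ => Q)
    (n := w.length) (fun _ => rfl) (fun _ => h0) (fun _ _ _ => h) (l := List.replicate n ())
    (by simp [List.isChain_iff_getElem])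
  rw [List.length_replicate] at h1
  rw [← h1, ← len_prod, List.map_flatMap, List.flatMap_replicate]
  simp

end GilbertHowie

/-! ### Klein bottle relations obstruct hyperbolicity. -/

namespace HyperbolicGroup

open SimpleGraph

theorem mulCayley_dist_mul_left {G : Type*} [Group G] (S : Set G) (g x y : G) :
    (mulCayley S).dist (g * x) (g * y) = (mulCayley S).dist x y := by
  -- With `edist`, unreachable pairs, for which `dist` is 0, need no separate treatment.
  have h : ∀ g x y : G, (mulCayley S).edist (g * x) (g * y) ≤ (mulCayley S).edist x y := by
    intro g x y
    refine le_iInf fun p => ?_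
    let f : mulCayley S →g mulCayley S :=
      ⟨fun z => g * z, fun h => mulCayley_adj_mul_iff_right.mpr h⟩
    have := edist_le (p.map f)
    rwa [Walk.length_map] at this
  refine congrArg ENat.toNat (le_antisymm (h g x y) ?_)
  have := h g⁻¹ (g * x) (g * y)
  rwa [inv_mul_cancel_left, inv_mul_cancel_left] at this

theorem mulCayley_connected {G : Type*} [Group G] {S : Set G} (hS : Subgroup.closure S = ⊤) :
    (mulCayley S).Connected := by
  have hs : ∀ s ∈ S, ∀ x, (mulCayley S).Reachable x (x * s) := by
    intro s hs x
    by_cases h : x = x * s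
    · rw [← h]
    · exact Adj.reachable ((mulCayley_adj' S _ _).mpr ⟨h, s, hs, Or.inl rfl⟩)
  have key : ∀ g : G, ∀ x, (mulCayley S).Reachable x (x * g) := by
    intro g
    induction (hS ▸ Subgroup.mem_top g : g ∈ Subgroup.closure S) using
      Subgroup.closure_induction with
    | mem s h => exact hs s h
    | one => simp
    | mul g h _ _ hg hh => intro x; rw [← mul_assoc]; exact (hg x).trans (hh _)
    | inv g _ hg => intro x; simpa using (hg (x * g⁻¹)).symm
  have : Nonempty G := ⟨1⟩
  refine .mk fun x y => ?_
  simpa using key (x⁻¹ * y) x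

/-- A function on a group that changes by bounded amounts under right multiplication by each
element is bounded by a multiple of every word length. -/
theorem exists_le_mul_dist {G : Type*} [Group G] {S : Set G} (hfin : S.Finite)
    (hS : Subgroup.closure S = ⊤) {l : G → ℕ} (hl : ∀ s, ∃ C, ∀ g, l (g * s) ≤ l g + C) :
    ∃ K, ∀ g, l g ≤ l 1 + K * (mulCayley S).dist 1 g := by
  choose C hC using hl
  obtain ⟨K, hK⟩ : ∃ K, ∀ s ∈ S, C s ≤ K ∧ C s⁻¹ ≤ K := by
    obtain ⟨K, hK⟩ := (hfin.image fun s => max (C s) (C s⁻¹)).bddAbove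
    exact ⟨K, fun s hs => max_le_iff.mp (hK ⟨s, hs, rfl⟩)⟩
  have hadj : ∀ x y, (mulCayley S).Adj x y → l y ≤ l x + K := by
    intro x y h
    obtain ⟨-, s, hs, rfl | rfl⟩ := (mulCayley_adj' S x y).mp h
    · exact (hC s x).trans (Nat.add_le_add_left (hK s hs).1 _)
    · have := hC s⁻¹ (y * s)
      rw [mul_inv_cancel_right] at this
      exact this.trans (Nat.add_le_add_left (hK s hs).2 _)
  have hwalk : ∀ x y (p : (mulCayley S).Walk x y), l y ≤ l x + K * p.length := by
    intro x y p
    induction p with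
    | nil => simp
    | cons h p ih =>
      have := hadj _ _ h
      rw [Walk.length_cons, mul_add, mul_one]
      omega
  refine ⟨K, fun g => ?_⟩
  obtain ⟨p, hp⟩ := (mulCayley_connected hS).exists_walk_length_eq_dist 1 g
  rw [← hp]
  exact hwalk 1 g p

/-- Two sequences which grow at least exponentially with base `2` cannot be such that doubling in
both directions only doubles the maximum. -/
theorem false_of_doubling {f g : ℕ → ℝ} {e C : ℝ} (he : 0 < e) (hf : ∀ k, e * 2 ^ k ≤ f k)
    (hg : ∀ k, e * 2 ^ k ≤ g k) (h : ∀ k j, f (k + 1) + g (j + 1) ≤ 2 * max (f k) (g j) + C) :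
    False := by
  have large : ∀ M : ℝ, ∃ n, ∀ k ≥ n, M ≤ e * 2 ^ k := fun M => by
    have := (tendsto_pow_atTop_atTop_of_one_lt (one_lt_two (α := ℝ))).const_mul_atTop he
    exact Filter.eventually_atTop.mp (this.eventually_ge_atTop M)
  obtain ⟨n, hn⟩ := large (max (2 * C) (g 0))
  -- If f grew by a factor below 3/2 at every step from n on, it could not stay above e · 2^k; the
  -- 4/3 below is 2 / (3/2).
  obtain ⟨k, hk, hk'⟩ : ∃ k ≥ n, 3 / 2 * f k ≤ f (k + 1) := by
    by_contra! hlt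
    have hle : ∀ i, f (n + i) ≤ (3 / 2) ^ i * f n := by
      intro i
      induction i with
      | zero => simp
      | succ i ih =>
        have := hlt (n + i) (by omega)
        rw [pow_succ, ← add_assoc]
        linarith
    have hb : ∀ i, (4 / 3 : ℝ) ^ i * (e * 2 ^ n) ≤ f n := by
      intro i
      have h1 := (hf (n + i)).trans (hle i)
      have h2 : (2 : ℝ) ^ (n + i) = 2 ^ n * ((4 / 3) ^ i * (3 / 2) ^ i) := by
        rw [← mul_pow, pow_add]; norm_num
      rw [h2] at h1
      have h3 : (0 : ℝ) < (3 / 2) ^ i := by positivity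
      refine le_of_mul_le_mul_left (le_of_eq_of_le ?_ h1) h3
      ring
    have ht := (tendsto_pow_atTop_atTop_of_one_lt (by norm_num : (1 : ℝ) < 4 / 3)).atTop_mul_const
      (by positivity : 0 < e * 2 ^ n)
    obtain ⟨i, hi⟩ := (ht.eventually_gt_atTop (f n)).exists
    exact absurd (hb i) (not_le.mpr hi)
  have hfk := (hn k hk).trans (hf k)
  have hC : 2 * C ≤ f k := (le_max_left _ _).trans hfk
  have h0 : g 0 ≤ f k := (le_max_right _ _).trans hfk
  -- With `k` fixed, g never exceeds f k: inductively g (j+1) ≤ 2 f k + C - (3/2) f k ≤ f k, since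
  -- 2C ≤ f k. This contradicts the growth of g.
  have hle : ∀ j, g j ≤ f k := by
    intro j
    induction j with
    | zero => exact h0
    | succ j ih =>
      have := h k j
      rw [max_eq_left ih] at this
      linarith
  obtain ⟨j, hj⟩ := large (f k + 1)
  linarith [hj j le_rfl, hg j, hle j]

/-- A group with elements satisfying the Klein bottle relation, both generating undistorted
infinite cyclic subgroups, is not hyperbolic. -/
theorem not_isHyperbolicGroup {G : Type*} [Group G] {l : G → ℕ} (h1 : l 1 = 0)
    (hl : ∀ s, ∃ C, ∀ g, l (g * s) ≤ l g + C) {a b : G} (hab : b * a * b⁻¹ = a⁻¹)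
    (ha : ∀ n : ℕ, n ≤ l (a ^ n)) (hb : ∀ n : ℕ, n ≤ l (b ^ n)) : ¬ IsHyperbolicGroup G := by
  rintro ⟨S, hfin, hS, δ, hδ⟩
  obtain ⟨K, hK⟩ := exists_le_mul_dist hfin hS hl
  have hconn := mulCayley_connected hS
  set d : G → G → ℝ := fun x y => (mulCayley S).dist x y with hd
  have four : ∀ x y z w, d x z + d y w ≤ max (d x y + d z w) (d y z + d x w) + 2 * δ := by
    intro x y z w
    have := hδ x y z w
    simp only [wordGromovProduct] at this
    change min ((d x w + d y w - d x y) / 2) ((d y w + d z w - d y z) / 2) - δ ≤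
      (d x w + d z w - d x z) / 2 at this
    rcases le_total (d x y + d z w) (d y z + d x w) with h | h
    · rw [max_eq_right h]
      rw [min_eq_right (by linarith)] at this
      linarith
    · rw [max_eq_left h]
      rw [min_eq_left (by linarith)] at this
      linarith
  set N : G → ℝ := fun g => d 1 g with hN
  have dN : ∀ x y, d x y = N (x⁻¹ * y) := by
    intro x y
    simp only [hN, hd]
    rw [← mulCayley_dist_mul_left S x 1, mul_one, mul_inv_cancel_left]
  have Ninv : ∀ x, N x⁻¹ = N x := by
    intro x
    have := dN x 1
    rw [mul_one] at this
    rw [← this]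
    simp only [hN, hd, dist_comm]
  have Nmul : ∀ x y, N (x * y) ≤ N x + N y := by
    intro x y
    have : (mulCayley S).dist 1 (x * y) ≤ (mulCayley S).dist 1 x + (mulCayley S).dist x (x * y) :=
      hconn.dist_triangle
    have h2 := dN x (x * y)
    rw [inv_mul_cancel_left] at h2
    rw [← h2]
    simp only [hN, hd]
    exact_mod_cast this
  have Nconj : ∀ x, N (b * x * b⁻¹) ≤ N x + 2 * N b := by
    intro x
    linarith [Nmul (b * x) b⁻¹, Nmul b x, Ninv b]
  -- The quadruple 1, u, uv, v bounds N(uv) + N(u⁻¹v) by 2 max(N u, N v) + 2δ; the quadruple u⁻¹, v,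
  -- u, v⁻¹ bounds N(u²) + N(v²) by 2 max(N(uv), N(u⁻¹v)) + 2δ. Since N(uv) and N(u⁻¹v) differ by at
  -- most 2 N(b), combining the two costs 6 N(b).
  have step : ∀ u v : G, Commute u v → b * u * b⁻¹ = u⁻¹ → b * v * b⁻¹ = v →
      N (u ^ 2) + N (v ^ 2) ≤ 2 * max (N u) (N v) + (4 * δ + 6 * N b) := by
    intro u v huv hu hv
    have hc1 : N (u⁻¹ * v) ≤ N (u * v) + 2 * N b := by
      have := Nconj (u * v)
      rwa [← conj_mul, hu, hv] at this
    have hc2 : N (u * v) ≤ N (u⁻¹ * v) + 2 * N b := by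
      have := Nconj (u⁻¹ * v)
      rwa [← conj_mul, hv, ← conj_inv, hu, inv_inv] at this
    have f1 := four 1 u (u * v) v
    have f2 := four u⁻¹ v u v⁻¹
    have e1 : d 1 (u * v) = N (u * v) := rfl
    have e2 : d u v = N (u⁻¹ * v) := dN _ _
    have e3 : d 1 u = N u := rfl
    have e4 : d (u * v) v = N u := by
      rw [dN, huv.eq, mul_inv_rev, mul_assoc, inv_mul_cancel, mul_one, Ninv]
    have e5 : d u (u * v) = N v := by rw [dN, inv_mul_cancel_left]
    have e6 : d 1 v = N v := rfl
    have e7 : d u⁻¹ u = N (u ^ 2) := by rw [dN, inv_inv, pow_two]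
    have e8 : d v v⁻¹ = N (v ^ 2) := by rw [dN, ← Ninv, mul_inv_rev, inv_inv, pow_two]
    have e9 : d u⁻¹ v = N (u * v) := by rw [dN, inv_inv]
    have e10 : d u v⁻¹ = N (u * v) := by rw [dN, ← Ninv, mul_inv_rev, inv_inv, inv_inv, huv.eq]
    have e11 : d v u = N (u⁻¹ * v) := by rw [dN, ← Ninv, mul_inv_rev, inv_inv]
    have e12 : d u⁻¹ v⁻¹ = N (u⁻¹ * v) := by
      rw [dN, inv_inv, ← Ninv, mul_inv_rev, inv_inv, (huv.inv_left).eq]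
    rw [e1, e2, e3, e4, e5, e6, ← two_mul, ← two_mul, ← mul_max_of_nonneg _ _ zero_le_two] at f1
    rw [e7, e8, e9, e10, e11, e12, ← two_mul, ← two_mul, ← mul_max_of_nonneg _ _ zero_le_two] at f2
    have := max_le (by linarith [hc1, hc2] : N (u * v) ≤ N (u * v) + 2 * N b) hc1
    linarith
  have hau : ∀ n : ℕ, b * a ^ n * b⁻¹ = (a ^ n)⁻¹ := fun n => by rw [← conj_pow, hab, inv_pow]
  have hcomm : ∀ m n : ℕ, Commute (a ^ m) ((b ^ 2) ^ n) := by
    intro m n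
    refine Commute.pow_pow ?_ m n
    rw [commute_iff_eq, eq_comm, ← mul_inv_eq_iff_eq_mul]
    have : b ^ 2 * a * (b ^ 2)⁻¹ = b * (b * a * b⁻¹) * b⁻¹ := by
      simp only [pow_two, mul_inv_rev, mul_assoc]
    rw [this, hab, ← conj_inv, hab, inv_inv]
  -- `K + 1` replaces `K` because `K` may be 0.
  have lower : ∀ (c : G), (∀ n : ℕ, n ≤ l (c ^ n)) → ∀ n : ℕ, ((K : ℝ) + 1)⁻¹ * n ≤ N (c ^ n) := by
    intro c hc n
    have h2 := (hc n).trans (hK (c ^ n))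
    rw [h1, zero_add] at h2
    have h3 : (n : ℝ) ≤ K * N (c ^ n) := by
      simp only [hN, hd]
      exact_mod_cast h2
    have h4 : 0 ≤ N (c ^ n) := by positivity
    rw [inv_mul_le_iff₀ (by positivity)]
    linarith
  -- Exponents 2^k turn squaring into a step of the index, and the powers of a and of b² may be
  -- chosen independently.
  refine false_of_doubling (f := fun k => N (a ^ 2 ^ k)) (g := fun k => N ((b ^ 2) ^ 2 ^ k))
    (e := ((K : ℝ) + 1)⁻¹) (C := 4 * δ + 6 * N b) (by positivity) ?_ ?_ ?_
  · intro k
    exact_mod_cast lower a ha (2 ^ k)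
  · intro k
    refine le_trans ?_ (lower (b ^ 2) (fun n => ?_) (2 ^ k))
    · push_cast; rfl
    · rw [← pow_mul]
      exact (by omega : n ≤ 2 * n).trans (hb _)
  · intro k j
    have := step (a ^ 2 ^ k) ((b ^ 2) ^ 2 ^ j) (hcomm _ _) (hau _) (by
      rw [← pow_mul, ← pow_succ', pow_succ, mul_inv_cancel_right])
    rwa [← pow_mul, ← pow_mul, ← pow_succ, ← pow_succ] at this

end HyperbolicGroup

namespace GilbertHowie

/-! ### The Klein bottle subgroup and the free subgroup -/

theorem mul_mul_eq_of_relations {G : Type*} [Group G] {x₀ x₁ x₂ x₃ x₄ x₅ x₆ x₇ x₈ x₉ : G}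
    (h₀ : x₀ * x₇ = x₁) (h₁ : x₁ * x₈ = x₂) (h₂ : x₂ * x₉ = x₃) (h₃ : x₃ * x₀ = x₄)
    (h₄ : x₄ * x₁ = x₅) (h₅ : x₅ * x₂ = x₆) (h₆ : x₆ * x₃ = x₇) (h₇ : x₇ * x₄ = x₈)
    (h₈ : x₈ * x₅ = x₉) (h₉ : x₉ * x₆ = x₀) :
    x₀ * x₅ * (x₁ * x₀ * x₂ * x₁ * x₃) * (x₀ * x₅) = x₁ * x₀ * x₂ * x₁ * x₃ := by
  -- Each of the first two identities inserts a letter with its inverse so that the triangle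
  -- relations apply on both sides of it.
  have e₁ : x₀ * x₅ * x₁ * x₀ = x₁ * x₀ * x₁ * x₆ := calc
    _ = x₀ * (x₅ * (x₁ * x₈)) * x₈⁻¹ * x₀ := by group
    _ = x₀ * x₆ * x₈⁻¹ * x₀ := by rw [h₁, h₅]
    _ = x₀ * (x₆ * x₃) * x₃⁻¹ * x₈⁻¹ * x₀ := by group
    _ = x₁ * x₃⁻¹ * x₈⁻¹ * (x₈ * x₅ * x₆) := by rw [h₆, h₀, h₈, h₉]
    _ = x₁ * x₃⁻¹ * x₅ * x₆ := by group
    _ = x₁ * x₃⁻¹ * (x₃ * x₀ * x₁) * x₆ := by rw [h₃, h₄]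
    _ = _ := by group
  have e₂ : x₁ * x₆ * x₂ * x₁ = x₂ * x₄⁻¹ * x₆ * x₇ := calc
    _ = x₁ * (x₆ * (x₂ * x₉)) * x₉⁻¹ * x₁ := by group
    _ = x₁ * x₇ * x₉⁻¹ * x₁ := by rw [h₂, h₆]
    _ = x₁ * (x₇ * x₄) * x₄⁻¹ * x₉⁻¹ * x₁ := by group
    _ = x₂ * x₄⁻¹ * x₉⁻¹ * (x₉ * x₆ * x₇) := by rw [h₇, h₁, h₉, h₀]
    _ = _ := by group
  have e₃ : x₆ * x₇ * x₄ * x₅ = x₅ * x₃ := by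
    rw [mul_assoc x₆, h₇, mul_assoc, h₈, ← h₅, mul_assoc, h₂]
  calc
    _ = (x₀ * x₅ * x₁ * x₀) * (x₂ * x₁ * (x₃ * x₀) * x₅) := by group
    _ = x₁ * x₀ * (x₁ * x₆ * x₂ * x₁) * x₄ * x₅ := by rw [e₁, h₃]; group
    _ = x₁ * x₀ * x₂ * x₄⁻¹ * (x₆ * x₇ * x₄ * x₅) := by rw [e₂]; group
    _ = x₁ * x₀ * x₂ * x₄⁻¹ * (x₄ * x₁ * x₃) := by rw [e₃, h₄]
    _ = _ := by group

theorem x_mul_x (i : ZMod 10) :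
    (GilbertHowieGroup.x i * GilbertHowieGroup.x (i + ((7 : ℕ) : ZMod 10)) :
      GilbertHowieGroup 10 7) = GilbertHowieGroup.x (i + ((1 : ℕ) : ZMod 10)) :=
  mul_inv_eq_one.mp (PresentedGroup.one_of_mem ⟨i, rfl⟩)

open GilbertHowieGroup

/-- The image of the generator `a`. -/
def kleinA : GilbertHowieGroup 10 7 := x 0 * x 5

/-- The image of the generator `b`. -/
def kleinB : GilbertHowieGroup 10 7 := x 1 * x 0 * x 2 * x 1 * x 3

theorem kleinB_conj : kleinB * kleinA * kleinB⁻¹ = kleinA⁻¹ := by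
  have h : kleinA * kleinB * kleinA = kleinB :=
    mul_mul_eq_of_relations (x_mul_x 0) (x_mul_x 1) (x_mul_x 2) (x_mul_x 3) (x_mul_x 4)
      (x_mul_x 5) (x_mul_x 6) (x_mul_x 7) (x_mul_x 8) (x_mul_x 9)
  rw [mul_inv_eq_iff_eq_mul, eq_inv_mul_iff_mul_eq, ← mul_assoc]
  exact h

theorem kleinA_eq : ((([0, 10] : List (Fin 20)).map elt).prod) = kleinA := by
  simp [elt, kleinA]

theorem kleinB_eq : ((([2, 0, 4, 2, 6] : List (Fin 20)).map elt).prod) = kleinB := by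
  simp [elt, kleinB, mul_assoc]

theorem len_kleinA_pow (n : ℕ) : len (kleinA ^ n) = 2 * n := by
  -- `Q` contains the root and is closed under multiplication by the word.
  rw [← kleinA_eq, len_pow (Q := [(33, 0), (5, 10)]) (by decide +kernel) (by decide +kernel)]
  rfl

theorem len_kleinB_pow (n : ℕ) : len (kleinB ^ n) = 5 * n := by
  rw [← kleinB_eq, len_pow (Q := [(33, 0), (0, 6), (2, 18), (14, 18)]) (by decide +kernel)
    (by decide +kernel)]
  rfl

theorem zpow_ne_one {g : GilbertHowieGroup 10 7} (hg : ∀ n : ℕ, n ≤ len (g ^ n)) {n : ℤ}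
    (h : g ^ n = 1) : n = 0 := by
  have := hg n.natAbs
  rw [pow_natAbs_eq_one.mpr h, len_one] at this
  omega

/-- Conjugation by b or b⁻¹ inverts a, so powers of b can be moved to the right of powers of a. -/
theorem exists_zpow_mul_zpow (g : BaumslagSolitarGroup 1 (-1)) :
    ∃ m n : ℤ, g = BaumslagSolitarGroup.a ^ m * BaumslagSolitarGroup.b ^ n := by
  set a : BaumslagSolitarGroup 1 (-1) := BaumslagSolitarGroup.a with ha
  set b : BaumslagSolitarGroup 1 (-1) := BaumslagSolitarGroup.b with hb
  have h : b * a * b⁻¹ = a⁻¹ := by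
    have := PresentedGroup.one_of_mem (rels := baumslagSolitarRels 1 (-1)) rfl
    rw [map_mul, map_inv, mul_inv_eq_one] at this
    simp only [map_mul, map_inv, zpow_one, zpow_neg] at this
    exact this
  have h' : b⁻¹ * a * b = a⁻¹ := calc
    _ = b⁻¹ * a⁻¹⁻¹ * b := by rw [inv_inv]
    _ = b⁻¹ * (b * a * b⁻¹)⁻¹ * b := by rw [h]
    _ = a⁻¹ := by group
  have hg : g ∈ Subgroup.closure
      (Set.range (PresentedGroup.of (rels := baumslagSolitarRels 1 (-1)))) := by
    rw [PresentedGroup.closure_range_of]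
    trivial
  induction hg using Subgroup.closure_induction_left with
  | one => exact ⟨0, 0, by simp⟩
  | mul_left s hs g _ ih =>
    obtain ⟨i, rfl⟩ := hs
    obtain ⟨m, n, rfl⟩ := ih
    fin_cases i
    · refine ⟨1 + m, n, ?_⟩
      rw [zpow_add, zpow_one, mul_assoc]
      rfl
    · refine ⟨-m, 1 + n, ?_⟩
      change b * _ = _
      rw [zpow_neg, ← inv_zpow, ← h, conj_zpow, zpow_add, zpow_one]
      simp [mul_assoc]
  | inv_mul_cancel s hs g _ ih =>
    obtain ⟨i, rfl⟩ := hs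
    obtain ⟨m, n, rfl⟩ := ih
    fin_cases i
    · refine ⟨-1 + m, n, ?_⟩
      rw [zpow_add, zpow_neg_one, mul_assoc]
      rfl
    · refine ⟨-m, -1 + n, ?_⟩
      change b⁻¹ * _ = _
      have h2 := conj_zpow (i := m) (a := b⁻¹) (b := a)
      rw [inv_inv, h'] at h2
      rw [zpow_neg, ← inv_zpow, h2, zpow_add, zpow_neg_one]
      simp [mul_assoc]

/-- The embedding of the Klein bottle group. -/
def kleinHom : BaumslagSolitarGroup 1 (-1) →* GilbertHowieGroup 10 7 :=
  PresentedGroup.toGroup (f := ![kleinA, kleinB]) (by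
    rintro _ rfl
    simp [kleinB_conj])

theorem kleinHom_a : kleinHom BaumslagSolitarGroup.a = kleinA := PresentedGroup.toGroup.of _

theorem kleinHom_b : kleinHom BaumslagSolitarGroup.b = kleinB := PresentedGroup.toGroup.of _

theorem le_len_kleinA_pow (n : ℕ) : n ≤ len (kleinA ^ n) := by rw [len_kleinA_pow]; omega

theorem le_len_kleinB_pow (n : ℕ) : n ≤ len (kleinB ^ n) := by rw [len_kleinB_pow]; omega

theorem kleinHom_injective : Function.Injective kleinHom := by
  rw [injective_iff_map_eq_one]
  intro g hg
  obtain ⟨m, n, rfl⟩ := exists_zpow_mul_zpow g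
  rw [map_mul, map_zpow, map_zpow, kleinHom_a, kleinHom_b] at hg
  -- Conjugating a^m b^n = 1 by b gives a^(-m) b^n = 1; comparing the two yields a^(2m) = 1.
  have h2 : kleinA⁻¹ ^ m * kleinB ^ n = 1 := by
    rw [← kleinB_conj, conj_zpow]
    calc
      _ = kleinB * (kleinA ^ m * kleinB ^ n) * kleinB⁻¹ := by group
      _ = 1 := by rw [hg]; group
  have h3 : kleinA ^ (2 * m) = 1 := by
    have h4 := hg.trans h2.symm
    rw [mul_left_inj, inv_zpow] at h4
    rw [two_mul, zpow_add]
    nth_rewrite 1 [h4]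
    exact inv_mul_cancel _
  have hm : m = 0 := by
    have := zpow_ne_one le_len_kleinA_pow h3
    omega
  subst hm
  rw [zpow_zero, one_mul] at hg
  simp [zpow_ne_one le_len_kleinB_pow hg]

/-! ### The free subgroup generated by two squares. -/

/-- The words of the squares `x_0 ^ 2` and `x_8 ^ 2` and their inverses. -/
def squareWord (k : Fin 2 × Bool) : List (Fin 20) :=
  match k with
  | (0, true) => [0, 0]
  | (0, false) => [1, 1]
  | (1, true) => [16, 16]
  | (1, false) => [17, 17]

/-- The states of the normal forms ending with these squares. -/
def squareStates (k : Fin 2 × Bool) : List State :=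
  match k with
  | (0, true) => [(0, 0)]
  | (0, false) => [(4, 0), (9, 0)]
  | (1, true) => [(0, 16), (7, 16)]
  | (1, false) => [(9, 16), (22, 16)]

theorem squareWord_rises : ∀ j k : Fin 2 × Bool, (j.1 = k.1 → j.2 = k.2) →
    rises (squareWord k) (squareStates j) (squareStates k) = true := by
  decide +kernel

theorem squareWord_rises_root : ∀ k : Fin 2 × Bool,
    rises (squareWord k) [(33, 0)] (squareStates k) = true := by
  decide +kernel

theorem squareWord_prod (k : Fin 2 × Bool) : ((squareWord k).map elt).prod =
    cond k.2 ((![x 0 ^ 2, x 8 ^ 2] : Fin 2 → GilbertHowieGroup 10 7) k.1)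
      ((![x 0 ^ 2, x 8 ^ 2] : Fin 2 → GilbertHowieGroup 10 7) k.1)⁻¹ := by
  obtain ⟨i, b⟩ := k
  fin_cases i <;> cases b <;> simp [squareWord, elt, pow_two]

theorem lift_squares_injective : Function.Injective
    (FreeGroup.lift ![x 0 ^ 2, x 8 ^ 2] : FreeGroup (Fin 2) →* GilbertHowieGroup 10 7) := by
  rw [injective_iff_map_eq_one]
  intro z hz
  have h1 : ((z.toWord.flatMap squareWord).map elt).prod = 1 := by
    rw [← hz]
    conv_rhs => rw [← FreeGroup.mk_toWord (x := z), FreeGroup.lift_mk]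
    simp only [← squareWord_prod]
    induction z.toWord with
    | nil => rfl
    | cons k l ih => simp [ih]
  -- Being reduced is exactly the chain condition of `squareWord_rises`: consecutive letters with
  -- the same index have the same sign.
  have h2 := actWord_flatMap (w := squareWord) (Q := squareStates) (n := 2)
    (by decide) squareWord_rises_root squareWord_rises (FreeGroup.isReduced_toWord (x := z))
  rw [← len_prod, h1, len_one] at h2
  rw [← FreeGroup.toWord_eq_nil_iff]
  exact List.length_eq_zero_iff.mp (by omega)

end GilbertHowie

open GilbertHowieGroup in
theorem mainTheorem6 :
    -- `H(10,7)` is not hyperbolic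
    ¬ IsHyperbolicGroup (GilbertHowieGroup 10 7) ∧
    -- `x_0 x_5` and `x_1 x_0 x_2 x_1 x_3` generate a copy of the Klein bottle group `BS(1,-1)`
    (∃ f : BaumslagSolitarGroup 1 (-1) →* GilbertHowieGroup 10 7,
      Function.Injective f ∧
      f BaumslagSolitarGroup.a = x 0 * x 5 ∧
      f BaumslagSolitarGroup.b = x 1 * x 0 * x 2 * x 1 * x 3) ∧
    -- `y_0 ^ 2` and `y_4 ^ 2`, where `y_j = x_{2j}`, freely generate a free group of rank `2`
    Function.Injective
      (FreeGroup.lift ![x 0 ^ 2, x 8 ^ 2] : FreeGroup (Fin 2) →* GilbertHowieGroup 10 7) :=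
  ⟨HyperbolicGroup.not_isHyperbolicGroup GilbertHowie.len_one GilbertHowie.exists_len_mul_le
    GilbertHowie.kleinB_conj GilbertHowie.le_len_kleinA_pow GilbertHowie.le_len_kleinB_pow,
    ⟨GilbertHowie.kleinHom, GilbertHowie.kleinHom_injective, GilbertHowie.kleinHom_a,
      GilbertHowie.kleinHom_b⟩, GilbertHowie.lift_squares_injective⟩
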